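/- Write $M_d$ for the complex $d\times d$ matrices, $M_d^+$ for the positive semidefinite ones, $\mathrm T$ for the transpose map on $M_d$, and $(M_n\otimes M_d)^+$ for the positive semidefinite elements of $M_n\otimes M_d\cong M_{nd}$. An element of $M_n\otimes M_d$ is *separable* if it is a finite sum $\sum_i A_i\otimes B_i$ with $A_i\in M_n^+$, $B_i\in M_d^+$. Let $\Phi:M_d\to M_d$ be linear. - $\Phi$ is *positive* if $\Phi(M_d^+)\subseteq M_d^+$; it is *$k$-positive* if $\mathrm{id}_k\otimes\Phi$ maps $(M_k\otimes M_d)^+$ into itself; it is *completely positive* (CP) if it is $n$-positive for all $n\ge1$. - $\Phi$ is *entanglement breaking* (EB) if $(\mathrm{id}_n\otimes\Phi)(X)$ is separable for all $n\ge 1$ and all $X\in(M_n\otimes M_d)^+$; it is *$k$-entanglement breaking* ($k$-EB) if it is $k$-positive and $(\mathrm{id}_k\otimes\Phi)(X)$ is separable for all $X\in(M_k\otimes M_d)^+$. - $\Phi$ is *$k$-partially entanglement breaking* ($k$-PEB) if $\Phi(X)=\sum_{i=1}^n V_i^*XV_i$ for finitely many $V_i\in M_d$, each of rank at most $k$. Let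 $\mathcal P(d)$, $\mathcal P_k(d)$, $\mathcal{CP}(d)$, $\mathcal{PEB}_k(d)$, $\mathcal{EB}(d)$, $\mathcal{EB}_k(d)$ be the sets of positive, $k$-positive, CP, $k$-PEB, EB and $k$-EB maps on $M_d$, respectively, and let $\mathcal{EBCP}_k(d)=\mathcal{EB}_k(d)\cap\mathcal{CP}(d)$. A *mapping cone* is a closed convex cone $\mathcal C\subseteq\mathcal P(d)$ such that $\Phi\circ\Theta\circ\Psi\in\mathcal C$ for all $\Theta\in\mathcal C$ and $\Phi,\Psi\in\mathcal{CP}(d)$. A mapping cone is *typical* if it can be obtained from the cones $\mathcal P(d)$, $\mathcal{CP}(d)$, $\mathcal{EB}(d)$, $\mathcal P_j(d)$ and $\mathcal{PEB}_j(d)$ (all $j>1$) by finitely many applications of the operations $\mathcal C\mapsto\mathcal C\circ\mathrm T=\{\Phi\circ\mathrm T:\Phi\in\mathcal C\}$, $(\mathcal C_1,\mathcal C_2)\mapsto\mathcal C_1\cap\mathcal C_2$, and $(\mathcal C_1,\mathcal C_2)\mapsto\mathcal C_1\vee\mathcal C_2$, the smallest closed convex cone containing $\mathcal C_1\cup\mathcal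 C_2$. **Theorem.** Let $d\ge4$ and $1<k<d$. Then $\mathcal{EB}_k(d)$ and $\mathcal{EBCP}_k(d)$ are mapping cones, and neither of them is typical. -/

import Mathlib

open scoped ComplexOrder Kronecker Matrix Topology

namespace MappingCones

/-- The `d × d` complex matrices. -/
abbrev Mat (d : ℕ) : Type := Matrix (Fin d) (Fin d) ℂ

/-- Linear maps from the `d₁ × d₁` matrices to the `d₂ × d₂` matrices. -/
abbrev MatMap (d₁ d₂ : ℕ) : Type := Mat d₁ →ₗ[ℂ] Mat d₂

/-- The tensor product of the `k × k` and the `d × d` matrices, realised as the matrices indexed by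
pairs; the elementary tensor of `A` and `B` is the Kronecker product `A ⊗ₖ B = [a_ij B]`. -/
abbrev TMat (k d : ℕ) : Type := Matrix (Fin k × Fin d) (Fin k × Fin d) ℂ

/-- The map `id_k ⊗ Φ`: apply `Φ` to each of the `d₁ × d₁` blocks of `X`. -/
def idTensor {d₁ d₂ : ℕ} (k : ℕ) (Φ : MatMap d₁ d₂) (X : TMat k d₁) : TMat k d₂ :=
  Matrix.of fun p q => Φ (Matrix.of fun a b => X (p.1, a) (q.1, b)) p.2 q.2

theorem idTensor_kronecker {d₁ d₂ : ℕ} (k : ℕ) (Φ : MatMap d₁ d₂) (A : Mat k) (B : Mat d₁) :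
    idTensor k Φ (A ⊗ₖ B) = A ⊗ₖ Φ B := by
  ext p q
  have h : (Matrix.of fun a b => (A ⊗ₖ B) (p.1, a) (q.1, b)) = A p.1 q.1 • B := rfl
  change Φ (Matrix.of fun a b => (A ⊗ₖ B) (p.1, a) (q.1, b)) p.2 q.2 = _
  rw [h, map_smul]
  rfl

/-- `X` is a finite sum of tensor products of positive semidefinite matrices. -/
def IsSeparable {k d : ℕ} (X : TMat k d) : Prop :=
  ∃ (n : ℕ) (A : Fin n → Mat k) (B : Fin n → Mat d),
    (∀ i, (A i).PosSemidef) ∧ (∀ i, (B i).PosSemidef) ∧ X = ∑ i, A i ⊗ₖ B i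

def IsPositive {d₁ d₂ : ℕ} (Φ : MatMap d₁ d₂) : Prop :=
  ∀ X : Mat d₁, X.PosSemidef → (Φ X).PosSemidef

def IsKPositive {d₁ d₂ : ℕ} (k : ℕ) (Φ : MatMap d₁ d₂) : Prop :=
  ∀ X : TMat k d₁, X.PosSemidef → (idTensor k Φ X).PosSemidef

def IsCP {d₁ d₂ : ℕ} (Φ : MatMap d₁ d₂) : Prop :=
  ∀ k : ℕ, 1 ≤ k → IsKPositive k Φ

/-- Entanglement breaking maps. -/
def IsEB {d₁ d₂ : ℕ} (Φ : MatMap d₁ d₂) : Prop :=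
  ∀ k : ℕ, 1 ≤ k → ∀ X : TMat k d₁, X.PosSemidef → IsSeparable (idTensor k Φ X)

/-- `k`-entanglement breaking maps. -/
def IsKEB {d₁ d₂ : ℕ} (k : ℕ) (Φ : MatMap d₁ d₂) : Prop :=
  IsKPositive k Φ ∧ ∀ X : TMat k d₁, X.PosSemidef → IsSeparable (idTensor k Φ X)

/-- `k`-partially entanglement breaking maps: the maps `X ↦ ∑ i, (V i)ᴴ X (V i)` with finitely many
Choi-Kraus operators `V i`, all of rank at most `k`. -/
def IsKPEB {d₁ d₂ : ℕ} (k : ℕ) (Φ : MatMap d₁ d₂) : Prop :=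
  ∃ (n : ℕ) (V : Fin n → Matrix (Fin d₁) (Fin d₂) ℂ),
    (∀ i, (V i).rank ≤ k) ∧ ∀ X : Mat d₁, Φ X = ∑ i, (V i)ᴴ * X * V i

def P (d₁ d₂ : ℕ) : Set (MatMap d₁ d₂) := {Φ | IsPositive Φ}

def Pk (k d₁ d₂ : ℕ) : Set (MatMap d₁ d₂) := {Φ | IsKPositive k Φ}

def CP (d₁ d₂ : ℕ) : Set (MatMap d₁ d₂) := {Φ | IsCP Φ}

def PEBk (k d₁ d₂ : ℕ) : Set (MatMap d₁ d₂) := {Φ | IsKPEB k Φ}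

def EB (d₁ d₂ : ℕ) : Set (MatMap d₁ d₂) := {Φ | IsEB Φ}

def EBk (k d₁ d₂ : ℕ) : Set (MatMap d₁ d₂) := {Φ | IsKEB k Φ}

def EBCPk (k d₁ d₂ : ℕ) : Set (MatMap d₁ d₂) := {Φ | IsKEB k Φ ∧ IsCP Φ}

/-- The usual topology of the finite-dimensional space of linear maps (pointwise convergence). -/
noncomputable abbrev mapTopology (d₁ d₂ : ℕ) : TopologicalSpace (MatMap d₁ d₂) :=
  TopologicalSpace.induced (fun (Φ : MatMap d₁ d₂) (X : Mat d₁) => Φ X) inferInstance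

/-- Closed convex cones of linear maps. -/
structure IsClosedConvexCone {d₁ d₂ : ℕ} (C : Set (MatMap d₁ d₂)) : Prop where
  zero_mem : 0 ∈ C
  add_mem : ∀ Φ ∈ C, ∀ Ψ ∈ C, Φ + Ψ ∈ C
  smul_mem : ∀ c : ℝ, 0 ≤ c → ∀ Φ ∈ C, (c : ℂ) • Φ ∈ C
  isClosed : IsClosed[mapTopology d₁ d₂] C

/-- Mapping cones: closed convex cones of positive maps that are stable under composition with
completely positive maps on both sides. -/
structure IsMappingCone {d₁ d₂ : ℕ} (C : Set (MatMap d₁ d₂)) : Prop where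
  closedConvexCone : IsClosedConvexCone C
  subset_P : C ⊆ P d₁ d₂
  comp_mem : ∀ Θ ∈ C, ∀ Ψ ∈ CP d₁ d₁, ∀ Φ ∈ CP d₂ d₂, Φ ∘ₗ Θ ∘ₗ Ψ ∈ C

/-- The transpose map. -/
def T (d : ℕ) : MatMap d d := (Matrix.transposeLinearEquiv (Fin d) (Fin d) ℂ ℂ).toLinearMap

/-- `C ∘ T = {Φ ∘ T : Φ ∈ C}`. -/
def compT {d₁ d₂ : ℕ} (C : Set (MatMap d₁ d₂)) : Set (MatMap d₁ d₂) :=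
  (fun Φ => Φ ∘ₗ T d₁) '' C

/-- `C₁ ∨ C₂`, the smallest closed convex cone that contains `C₁ ∪ C₂`. -/
def join {d₁ d₂ : ℕ} (C₁ C₂ : Set (MatMap d₁ d₂)) : Set (MatMap d₁ d₂) :=
  ⋂₀ {K | IsClosedConvexCone K ∧ C₁ ∪ C₂ ⊆ K}

/-- Typical cones: those obtained from the standard ones by finitely many applications of
`C ↦ C ∘ T`, intersection and join. -/
inductive IsTypical {d₁ d₂ : ℕ} : Set (MatMap d₁ d₂) → Prop
  | pos : IsTypical (P d₁ d₂)
  | kPos (j : ℕ) (hj : 1 < j) : IsTypical (Pk j d₁ d₂)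
  | cp : IsTypical (CP d₁ d₂)
  | kPEB (j : ℕ) (hj : 1 < j) : IsTypical (PEBk j d₁ d₂)
  | eb : IsTypical (EB d₁ d₂)
  | transpose (C : Set (MatMap d₁ d₂)) (hC : IsTypical C) : IsTypical (compT C)
  | inter (C₁ C₂ : Set (MatMap d₁ d₂)) (h₁ : IsTypical C₁) (h₂ : IsTypical C₂) :
      IsTypical (C₁ ∩ C₂)
  | join (C₁ C₂ : Set (MatMap d₁ d₂)) (h₁ : IsTypical C₁) (h₂ : IsTypical C₂) :
      IsTypical (join C₁ C₂)

end MappingCones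

/-! Separable matrices are positive semidefinite and form a closed cone, so `EBk` consists of the
maps with separable `id_k ⊗ Φ (X)` for all positive `X`, and it is a closed cone. Precomposing with
a completely positive map keeps the input positive; postcomposing with a positive map keeps the
output separable. Intersecting with `CP` changes nothing in this argument.

Non-typicality rests on a dichotomy (`IsTypical.eq_EB_or_subset`): a typical cone is either `EB` or
contains `PEBk 2 ∩ compT (PEBk 2)`. All generators satisfy it. It survives transposition because `EB
∘ T = EB` and the intersection is transposition invariant, and it survives meets and joins because
`EB` lies in every typical cone and is closed. Two maps then exclude both alternatives.

The map `X ↦ k tr(X) 1 - Xᵀ` is `k`-EB and CP, but not EB when `k < d`. Its Choi matrix is `k 1 - F`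
with `F` the swap, and `tr (F (k 1 - F)) = kd - d² < 0`, while `F` is nonnegative on separable
matrices. On the other hand, a vector of `ℂᵏ ⊗ ℂᵈ` only involves a subspace of dimension `r ≤ k` of
`ℂᵈ`, and `r tr(X) 1 - Xᵀ` on `M_r` is EB.

The Horodecki state on `ℂ² ⊗ ℂ⁴` is entangled with positive partial transpose. The map with this
Choi matrix has Kraus operators of rank at most 2, also after composition with `T`, yet two levels
already detect its entanglement, so it is not `k`-EB for `k ≥ 2`. -/

namespace MappingCones

/-! ### Separable matrices. -/

section Separable

variable {k d : ℕ}

theorem IsSeparable.of_fintype {ι : Type*} [Fintype ι] {X : TMat k d} (A : ι → Mat k)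
    (B : ι → Mat d) (hA : ∀ i, (A i).PosSemidef) (hB : ∀ i, (B i).PosSemidef)
    (hX : X = ∑ i, A i ⊗ₖ B i) : IsSeparable X := by
  let e := Fintype.equivFin ι
  refine ⟨Fintype.card ι, fun i => A (e.symm i), fun i => B (e.symm i), fun i => hA _,
    fun i => hB _, ?_⟩
  rw [hX]
  exact (Equiv.sum_comp e.symm fun i => A i ⊗ₖ B i).symm

theorem isSeparable_zero : IsSeparable (0 : TMat k d) :=
  ⟨0, Fin.elim0, Fin.elim0, fun i => i.elim0, fun i => i.elim0, by simp⟩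

theorem isSeparable_kronecker {A : Mat k} {B : Mat d} (hA : A.PosSemidef) (hB : B.PosSemidef) :
    IsSeparable (A ⊗ₖ B) :=
  ⟨1, fun _ => A, fun _ => B, fun _ => hA, fun _ => hB, by simp⟩

theorem IsSeparable.add {X Y : TMat k d} (hX : IsSeparable X) (hY : IsSeparable Y) :
    IsSeparable (X + Y) := by
  obtain ⟨n, A, B, hA, hB, rfl⟩ := hX
  obtain ⟨m, A', B', hA', hB', rfl⟩ := hY
  refine IsSeparable.of_fintype (ι := Fin n ⊕ Fin m) (Sum.elim A A') (Sum.elim B B') ?_ ?_ ?_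
  · rintro (i | i) <;> simp [hA, hA']
  · rintro (i | i) <;> simp [hB, hB']
  · simp

theorem isSeparable_sum {ι : Type*} (s : Finset ι) (X : ι → TMat k d)
    (h : ∀ i ∈ s, IsSeparable (X i)) : IsSeparable (∑ i ∈ s, X i) :=
  Finset.sum_induction X IsSeparable (fun _ _ => IsSeparable.add) isSeparable_zero h

theorem IsSeparable.smul {X : TMat k d} (hX : IsSeparable X) {c : ℝ} (hc : 0 ≤ c) :
    IsSeparable (c • X) := by
  obtain ⟨n, A, B, hA, hB, rfl⟩ := hX
  refine ⟨n, fun i => c • A i, B, fun i => (hA i).smul hc, hB, ?_⟩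
  simp [Finset.smul_sum, Matrix.smul_kronecker]

theorem IsSeparable.posSemidef {X : TMat k d} (hX : IsSeparable X) : X.PosSemidef := by
  obtain ⟨n, A, B, hA, hB, rfl⟩ := hX
  exact Matrix.posSemidef_sum _ fun i _ => (hA i).kronecker (hB i)

theorem isSeparable_iff_exists_vec {X : TMat k d} : IsSeparable X ↔
    ∃ (ι : Type) (_ : Fintype ι) (x : ι → Fin k → ℂ) (y : ι → Fin d → ℂ),
      X = ∑ i, Matrix.vecMulVec (x i) (star (x i)) ⊗ₖ Matrix.vecMulVec (y i) (star (y i)) := by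
  constructor
  · rintro ⟨n, A, B, hA, hB, rfl⟩
    choose p v hv using fun i => Matrix.posSemidef_iff_eq_sum_vecMulVec.1 (hA i)
    choose q w hw using fun i => Matrix.posSemidef_iff_eq_sum_vecMulVec.1 (hB i)
    refine ⟨(Σ i : Fin n, Fin (p i) × Fin (q i)), inferInstance, fun i => v i.1 i.2.1,
      fun i => w i.1 i.2.2, ?_⟩
    rw [Fintype.sum_sigma]
    refine Finset.sum_congr rfl fun i _ => ?_
    rw [Fintype.sum_prod_type]
    ext a b
    conv_lhs => rw [hv i, hw i]
    simp only [Matrix.kroneckerMap_apply, Matrix.sum_apply, Finset.sum_mul_sum]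
  · rintro ⟨ι, _, x, y, rfl⟩
    exact IsSeparable.of_fintype _ _ (fun i => Matrix.posSemidef_vecMulVec_self_star _)
      (fun i => Matrix.posSemidef_vecMulVec_self_star _) rfl

end Separable

/-! ### The separable cone is closed. -/

theorem sum_eq_of_embedding {ι κ M : Type*} [Fintype ι] [Fintype κ] [AddCommMonoid M]
    (e : ι ↪ κ) (g : ι → M) (h : κ → M) (h₁ : ∀ i, h (e i) = g i)
    (h₂ : ∀ j, j ∉ Set.range e → h j = 0) : ∑ j, h j = ∑ i, g i := by
  rw [← Finset.sum_subset (Finset.subset_univ (Finset.univ.map e))]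
  · simp [h₁]
  · intro j _ hj
    exact h₂ j (by simpa using hj)

/-- In finite dimension the convex hull of a compact set is compact. -/
theorem isCompact_convexHull_of_isCompact {E : Type*} [AddCommGroup E] [Module ℝ E]
    [TopologicalSpace E] [ContinuousAdd E] [ContinuousSMul ℝ E] [FiniteDimensional ℝ E]
    {s : Set E} (hs : IsCompact s) : IsCompact (convexHull ℝ s) := by
  rcases s.eq_empty_or_nonempty with rfl | ⟨x₀, hx₀⟩
  · simp
  let N := Module.finrank ℝ E + 1
  let f : (Fin N → ℝ) × (Fin N → E) → E := fun p => ∑ i, p.1 i • p.2 i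
  have hf : Continuous f := by fun_prop
  have hK : IsCompact (f '' (stdSimplex ℝ (Fin N) ×ˢ Set.univ.pi fun _ => s)) :=
    ((isCompact_stdSimplex ℝ (Fin N)).prod (isCompact_univ_pi fun _ => hs)).image hf
  convert hK
  apply Set.Subset.antisymm
  · intro x hx
    obtain ⟨ι, _, z, w, hz, hind, hw, hw1, rfl⟩ := eq_pos_convex_span_of_mem_convexHull hx
    have hcard : Fintype.card ι ≤ Fintype.card (Fin N) := by
      rw [Fintype.card_fin]
      exact hind.card_le_finrank_succ.trans (Nat.succ_le_succ (Submodule.finrank_le _))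
    obtain ⟨e⟩ := Function.Embedding.nonempty_of_card_le hcard
    -- Carathéodory gives at most `N` points; the unused slots get weight `0` and the dummy point
    -- `x₀`.
    refine ⟨(Function.extend e w 0, Function.extend e z fun _ => x₀), ⟨⟨?_, ?_⟩, ?_⟩, ?_⟩
    · intro j
      by_cases hj : ∃ i, e i = j
      · obtain ⟨i, rfl⟩ := hj
        simpa [e.injective.extend_apply] using (hw i).le
      · simp [Function.extend_apply' _ _ _ hj]
    · rw [← hw1]
      exact sum_eq_of_embedding e _ _ (fun i => e.injective.extend_apply _ _ _)
        fun j hj => Function.extend_apply' _ _ _ hj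
    · intro j _
      by_cases hj : ∃ i, e i = j
      · obtain ⟨i, rfl⟩ := hj
        simpa [e.injective.extend_apply] using hz ⟨i, rfl⟩
      · simpa [Function.extend_apply' _ _ _ hj] using hx₀
    · refine sum_eq_of_embedding e _ _ (fun i => ?_) fun j hj => ?_
      · simp [e.injective.extend_apply]
      · have : ¬ ∃ i, e i = j := hj
        simp [Function.extend_apply' _ _ _ this]
  · rintro _ ⟨⟨w, z⟩, ⟨hw, hz⟩, rfl⟩
    exact (convex_convexHull ℝ s).sum_mem (fun i _ => hw.1 i) hw.2
      fun i _ => subset_convexHull ℝ s (hz i trivial)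

theorem isClosed_posSemidef {n : Type*} [Fintype n] :
    IsClosed {X : Matrix n n ℂ | X.PosSemidef} := by
  simp only [Matrix.posSemidef_iff_dotProduct_mulVec, Set.ofPred_and, Set.ofPred_forall]
  refine IsClosed.inter (isClosed_eq (by fun_prop) continuous_id)
    (isClosed_iInter fun x => isClosed_le continuous_const ?_)
  fun_prop

section Closed

variable {k d : ℕ}

/-- The product state of two vectors. -/
noncomputable def productState (p : EuclideanSpace ℂ (Fin k) × EuclideanSpace ℂ (Fin d)) : TMat k d :=
  Matrix.vecMulVec p.1.ofLp (star p.1.ofLp) ⊗ₖ Matrix.vecMulVec p.2.ofLp (star p.2.ofLp)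

theorem continuous_productState : Continuous (productState (k := k) (d := d)) := by
  refine continuous_pi fun a => continuous_pi fun b => ?_
  simp only [productState, Matrix.kroneckerMap_apply, Matrix.vecMulVec_apply, Pi.star_apply]
  fun_prop

theorem trace_vecMulVec_star {n : ℕ} (x : EuclideanSpace ℂ (Fin n)) :
    (Matrix.vecMulVec x.ofLp (star x.ofLp)).trace = ((‖x‖ ^ 2 : ℝ) : ℂ) := by
  rw [EuclideanSpace.norm_sq_eq]
  simp [Matrix.trace, Matrix.vecMulVec_apply, Complex.mul_conj, Complex.normSq_eq_norm_sq]

theorem trace_productState (p : EuclideanSpace ℂ (Fin k) × EuclideanSpace ℂ (Fin d)) :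
    (productState p).trace = ((‖p.1‖ ^ 2 * ‖p.2‖ ^ 2 : ℝ) : ℂ) := by
  rw [productState, Matrix.trace_kronecker, trace_vecMulVec_star, trace_vecMulVec_star]
  push_cast
  rfl

theorem productState_smul (a b : ℝ)
    (p : EuclideanSpace ℂ (Fin k) × EuclideanSpace ℂ (Fin d)) :
    productState (a • p.1, b • p.2) = (a ^ 2 * b ^ 2) • productState p := by
  ext i j
  simp [productState, Matrix.kroneckerMap_apply, Matrix.vecMulVec_apply]
  ring

theorem isSeparable_productState (p : EuclideanSpace ℂ (Fin k) × EuclideanSpace ℂ (Fin d)) :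
    IsSeparable (productState p) :=
  isSeparable_kronecker (Matrix.posSemidef_vecMulVec_self_star _)
    (Matrix.posSemidef_vecMulVec_self_star _)

/-- The convex hull of the normalised product states. -/
def normalizedSeparable (k d : ℕ) : Set (TMat k d) :=
  convexHull ℝ (productState '' (Metric.sphere 0 1 ×ˢ Metric.sphere 0 1))

theorem isCompact_normalizedSeparable : IsCompact (normalizedSeparable k d) :=
  isCompact_convexHull_of_isCompact
    (((isCompact_sphere _ _).prod (isCompact_sphere _ _)).image continuous_productState)

theorem isSeparable_of_mem_normalizedSeparable {X : TMat k d} (hX : X ∈ normalizedSeparable k d) :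
    IsSeparable X := by
  refine convexHull_min (t := {X | IsSeparable X}) ?_ ?_ hX
  · rintro _ ⟨p, -, rfl⟩
    exact isSeparable_productState p
  · intro X hX Y hY a b ha hb _
    exact (IsSeparable.smul hX ha).add (IsSeparable.smul hY hb)

/-- The weight `‖x‖² ‖y‖²` is the trace of the product term, so division by the total trace leaves a
convex combination of normalised product states. -/
theorem IsSeparable.inv_trace_smul_mem {X : TMat k d} (hX : IsSeparable X)
    (h0 : X.trace.re ≠ 0) : X.trace.re⁻¹ • X ∈ normalizedSeparable k d := by
  obtain ⟨ι, _, x, y, rfl⟩ := isSeparable_iff_exists_vec.1 hX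
  let p : ι → EuclideanSpace ℂ (Fin k) × EuclideanSpace ℂ (Fin d) :=
    fun i => (WithLp.toLp 2 (x i), WithLp.toLp 2 (y i))
  let w : ι → ℝ := fun i => ‖(p i).1‖ ^ 2 * ‖(p i).2‖ ^ 2
  let z : ι → TMat k d := fun i => productState (‖(p i).1‖⁻¹ • (p i).1, ‖(p i).2‖⁻¹ • (p i).2)
  have hw : ∀ i, 0 ≤ w i := fun i => by positivity
  have hsum : (∑ i, Matrix.vecMulVec (x i) (star (x i)) ⊗ₖ Matrix.vecMulVec (y i) (star (y i)) :
      TMat k d) = ∑ i, productState (p i) := rfl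
  have htr : (∑ i, productState (p i)).trace.re = ∑ i, w i := by
    simp only [Matrix.trace_sum, trace_productState, Complex.re_sum, Complex.ofReal_re, w]
  have hwz : ∀ i, w i • z i = productState (p i) := by
    intro i
    by_cases h : w i = 0
    · have h' : ‖(p i).1‖ = 0 ∨ ‖(p i).2‖ = 0 := by simpa [w] using h
      rw [h, zero_smul]
      rcases h' with h' | h' <;>
      · rw [norm_eq_zero] at h'
        ext a b
        simp [productState, h']
    · have h' : ‖(p i).1‖ ≠ 0 ∧ ‖(p i).2‖ ≠ 0 := by simpa [w] using h
      simp only [z, w, productState_smul, smul_smul]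
      rw [show ‖(p i).1‖ ^ 2 * ‖(p i).2‖ ^ 2 * (‖(p i).1‖⁻¹ ^ 2 * ‖(p i).2‖⁻¹ ^ 2) = 1 by
        have := h'.1
        have := h'.2
        field_simp, one_smul]
  rw [hsum] at h0 ⊢
  rw [htr] at h0 ⊢
  have hpos : 0 < ∑ i, w i := lt_of_le_of_ne (Finset.sum_nonneg fun i _ => hw i) h0.symm
  have hc : (∑ i, w i)⁻¹ • ∑ i, productState (p i) = Finset.univ.centerMass w z := by
    simp only [Finset.centerMass, hwz]
  -- Terms of weight zero are dropped: their vectors cannot be normalised.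
  rw [hc, ← Finset.centerMass_filter_ne_zero]
  refine Finset.centerMass_mem_convexHull _ (fun i _ => hw i) ?_ fun i hi => ?_
  · rwa [Finset.sum_filter_ne_zero]
  · have h' : ‖(p i).1‖ ≠ 0 ∧ ‖(p i).2‖ ≠ 0 := by simpa [w] using hi
    refine ⟨_, ⟨?_, ?_⟩, rfl⟩
    · simp [norm_smul, h'.1]
    · simp [norm_smul, h'.2]

/-- The cone has a compact base, the slice of trace one. A limit of nonzero trace is rescaled into
this base; a limit of trace zero is positive semidefinite, hence `0`. -/
theorem isClosed_isSeparable : IsClosed {X : TMat k d | IsSeparable X} := by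
  refine isClosed_of_closure_subset fun X hX => ?_
  have hpsd : X.PosSemidef :=
    closure_minimal (fun Y hY => IsSeparable.posSemidef hY) isClosed_posSemidef hX
  have hcont : Continuous fun Y : TMat k d => Y.trace.re :=
    Complex.continuous_re.comp (by fun_prop)
  by_cases h0 : X.trace.re = 0
  · have him : X.trace.im = 0 := (Complex.nonneg_iff.1 hpsd.trace_nonneg).2.symm
    have : X = 0 := hpsd.trace_eq_zero_iff.1 (Complex.ext h0 him)
    rw [this]
    exact isSeparable_zero
  · have ht : Filter.Tendsto (fun Y : TMat k d => Y.trace.re⁻¹ • Y) (𝓝 X)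
        (𝓝 (X.trace.re⁻¹ • X)) := (hcont.continuousAt.inv₀ h0).smul continuousAt_id
    have hne : ∀ᶠ Y : TMat k d in 𝓝 X, Y.trace.re ≠ 0 := hcont.continuousAt.eventually_ne h0
    have hmem : X.trace.re⁻¹ • X ∈ normalizedSeparable k d :=
      isCompact_normalizedSeparable.isClosed.mem_of_frequently_of_tendsto
        (((mem_closure_iff_frequently.1 hX).and_eventually hne).mono
          fun Y hY => hY.1.inv_trace_smul_mem hY.2) ht
    have h := (isSeparable_of_mem_normalizedSeparable hmem).smul
      (Complex.nonneg_iff.1 hpsd.trace_nonneg).1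
    rwa [smul_smul, mul_inv_cancel₀ h0, one_smul] at h

end Closed

/-! ### Amplifications of linear maps. -/

section IdTensor

variable {k d₁ d₂ d₃ : ℕ}

/-- The block of `X` at the position `(i, j)`. -/
def block (X : TMat k d₁) (i j : Fin k) : Mat d₁ := Matrix.of fun a b => X (i, a) (j, b)

theorem block_apply (X : TMat k d₁) (i j : Fin k) (a b : Fin d₁) :
    block X i j a b = X (i, a) (j, b) := rfl

theorem idTensor_apply (Φ : MatMap d₁ d₂) (X : TMat k d₁) (p q : Fin k × Fin d₂) :
    idTensor k Φ X p q = Φ (block X p.1 q.1) p.2 q.2 := rfl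

theorem idTensor_smul (c : ℝ) (Φ : MatMap d₁ d₂) (X : TMat k d₁) :
    idTensor k ((c : ℂ) • Φ) X = c • idTensor k Φ X := by
  ext p q
  simp [idTensor_apply]

theorem idTensor_sum_right {ι : Type*} (s : Finset ι) (Φ : MatMap d₁ d₂) (X : ι → TMat k d₁) :
    idTensor k Φ (∑ i ∈ s, X i) = ∑ i ∈ s, idTensor k Φ (X i) := by
  ext p q
  have h : block (∑ i ∈ s, X i) p.1 q.1 = ∑ i ∈ s, block (X i) p.1 q.1 := by
    ext a b
    simp [block_apply, Matrix.sum_apply]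
  simp only [idTensor_apply, Matrix.sum_apply]
  rw [h, map_sum, Matrix.sum_apply]

theorem idTensor_comp (Φ : MatMap d₂ d₃) (Ψ : MatMap d₁ d₂) (X : TMat k d₁) :
    idTensor k (Φ ∘ₗ Ψ) X = idTensor k Φ (idTensor k Ψ X) := rfl

theorem continuous_idTensor_apply (X : TMat k d₁) :
    Continuous fun F : Mat d₁ → Mat d₂ =>
      (Matrix.of fun p q => F (block X p.1 q.1) p.2 q.2 : TMat k d₂) := by
  refine continuous_pi fun p => continuous_pi fun q => ?_
  have h : Continuous fun M : Mat d₂ => M p.2 q.2 := continuous_id.matrix_elem p.2 q.2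
  exact h.comp (continuous_apply (block X p.1 q.1))

theorem isClosed_setOf_idTensor_mem {S : Set (TMat k d₂)} (hS : IsClosed S) (X : TMat k d₁) :
    IsClosed[mapTopology d₁ d₂] {Φ | idTensor k Φ X ∈ S} :=
  isClosed_induced_iff.2 ⟨_, hS.preimage (continuous_idTensor_apply X), rfl⟩

/-- Plain positivity suffices, since the map only meets the second tensor factors. -/
theorem idTensor_separable {Φ : MatMap d₁ d₂} (hΦ : IsPositive Φ) {X : TMat k d₁}
    (hX : IsSeparable X) : IsSeparable (idTensor k Φ X) := by
  obtain ⟨n, A, B, hA, hB, rfl⟩ := hX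
  rw [idTensor_sum_right]
  refine isSeparable_sum _ _ fun i _ => ?_
  rw [idTensor_kronecker]
  exact isSeparable_kronecker (hA i) (hΦ _ (hB i))

end IdTensor

/-! ### Positivity and complete positivity. -/

section Positivity

variable {k d₁ d₂ d₃ : ℕ}

/-- `X` is embedded as the corner `E₀₀ ⊗ X`, and the same corner of the image is read off. -/
theorem IsKPositive.isPositive (hk : 1 ≤ k) {Φ : MatMap d₁ d₂} (h : IsKPositive k Φ) :
    IsPositive Φ := by
  intro X hX
  let i : Fin k := ⟨0, hk⟩
  have hE : (Matrix.single i i (1 : ℂ)).PosSemidef := by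
    rw [Matrix.single_eq_single_vecMulVec_single]
    convert! Matrix.posSemidef_vecMulVec_self_star (Pi.single i (1 : ℂ))
    simp
  have h1 := (h _ (hE.kronecker hX)).submatrix fun a : Fin d₂ => (i, a)
  rw [idTensor_kronecker] at h1
  convert! h1 using 1
  ext a b
  simp

theorem IsCP.isPositive {Φ : MatMap d₁ d₂} (h : IsCP Φ) : IsPositive Φ :=
  (h 1 le_rfl).isPositive le_rfl

theorem IsEB.isCP {Φ : MatMap d₁ d₂} (h : IsEB Φ) : IsCP Φ :=
  fun k hk X hX => (h k hk X hX).posSemidef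

theorem isKEB_iff {Φ : MatMap d₁ d₂} :
    IsKEB k Φ ↔ ∀ X : TMat k d₁, X.PosSemidef → IsSeparable (idTensor k Φ X) :=
  ⟨fun h => h.2, fun h => ⟨fun X hX => (h X hX).posSemidef, h⟩⟩

theorem IsCP.comp {Φ : MatMap d₂ d₃} {Ψ : MatMap d₁ d₂} (hΦ : IsCP Φ) (hΨ : IsCP Ψ) :
    IsCP (Φ ∘ₗ Ψ) :=
  fun k hk X hX => hΦ k hk _ (hΨ k hk X hX)

theorem block_kraus (V : Matrix (Fin d₁) (Fin d₂) ℂ) (X : TMat k d₁) :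
    (Matrix.of fun p q => (Vᴴ * block X p.1 q.1 * V) p.2 q.2) =
      ((1 : Mat k) ⊗ₖ V)ᴴ * X * ((1 : Mat k) ⊗ₖ V) := by
  ext p q
  simp [Matrix.mul_apply, Fintype.sum_prod_type, Matrix.kroneckerMap_apply, block_apply,
    Matrix.one_apply, Finset.sum_mul, apply_ite (starRingEnd ℂ), ite_mul, mul_ite]

theorem isCP_of_kraus {ι : Type*} [Fintype ι] (V : ι → Matrix (Fin d₁) (Fin d₂) ℂ) {Φ : MatMap d₁ d₂}
    (h : ∀ X, Φ X = ∑ i, (V i)ᴴ * X * V i) : IsCP Φ := by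
  intro k _ X hX
  have : idTensor k Φ X = ∑ i, ((1 : Mat k) ⊗ₖ V i)ᴴ * X * ((1 : Mat k) ⊗ₖ V i) := by
    ext p q
    simp only [idTensor_apply, h, ← block_kraus, Matrix.sum_apply, Matrix.of_apply]
  rw [this]
  exact Matrix.posSemidef_sum _ fun i _ => hX.conjTranspose_mul_mul_same _

theorem IsKPEB.isCP {j : ℕ} {Φ : MatMap d₁ d₂} (h : IsKPEB j Φ) : IsCP Φ := by
  obtain ⟨n, V, -, h⟩ := h
  exact isCP_of_kraus V h

theorem IsKPEB.mono {i j : ℕ} (hij : i ≤ j) {Φ : MatMap d₁ d₂} (h : IsKPEB i Φ) : IsKPEB j Φ := by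
  obtain ⟨n, V, hV, h⟩ := h
  exact ⟨n, V, fun l => (hV l).trans hij, h⟩

end Positivity

/-! ### Entanglement breaking maps as measure-and-prepare maps. -/

section EntanglementBreaking

variable {k d₁ d₂ d₃ : ℕ}

/-- The cone generated by the maps `X ↦ tr(A X) B` with `A` and `B` positive semidefinite. -/
def measurePrepare (d₁ d₂ : ℕ) : AddSubmonoid (MatMap d₁ d₂) :=
  AddSubmonoid.closure {Φ | ∃ (A : Mat d₁) (B : Mat d₂), A.PosSemidef ∧ B.PosSemidef ∧
    ∀ X, Φ X = (A * X).trace • B}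

/-- The map `X ↦ tr(A X) B`. -/
noncomputable def traceMap (A : Mat d₁) (B : Mat d₂) : MatMap d₁ d₂ :=
  (Matrix.traceLinearMap (Fin d₁) ℂ ℂ ∘ₗ LinearMap.mulLeft ℂ A).smulRight B

theorem traceMap_apply (A : Mat d₁) (B : Mat d₂) (X : Mat d₁) :
    traceMap A B X = (A * X).trace • B := rfl

theorem traceMap_mem {A : Mat d₁} {B : Mat d₂} (hA : A.PosSemidef) (hB : B.PosSemidef) :
    traceMap A B ∈ measurePrepare d₁ d₂ :=
  AddSubmonoid.subset_closure ⟨A, B, hA, hB, fun _ => rfl⟩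

theorem trace_vecMulVec_mul {n : ℕ} (v w : Fin n → ℂ) (X : Mat n) :
    (Matrix.vecMulVec v w * X).trace = ∑ a, ∑ b, w a * X a b * v b := by
  simp only [Matrix.trace, Matrix.diag, Matrix.mul_apply, Matrix.vecMulVec_apply]
  rw [Finset.sum_comm]
  exact Finset.sum_congr rfl fun a _ => Finset.sum_congr rfl fun b _ => by ring

/-- For `A = ∑ v v*` this partial trace is the sum of the compressions of `X` by `1 ⊗ v`. -/
theorem posSemidef_trace_block {A : Mat d₁} (hA : A.PosSemidef) {X : TMat k d₁}
    (hX : X.PosSemidef) : (Matrix.of fun i j => (A * block X i j).trace).PosSemidef := by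
  obtain ⟨m, v, rfl⟩ := Matrix.posSemidef_iff_eq_sum_vecMulVec.1 hA
  let W : Fin m → Matrix (Fin k × Fin d₁) (Fin k) ℂ := fun l =>
    Matrix.of fun p i => if p.1 = i then v l p.2 else 0
  have : (Matrix.of fun i j => ((∑ l, Matrix.vecMulVec (v l) (star (v l))) * block X i j).trace) =
      ∑ l, (W l)ᴴ * X * W l := by
    ext i j
    simp only [Matrix.of_apply, Finset.sum_mul, Matrix.trace_sum, Matrix.sum_apply,
      trace_vecMulVec_mul]
    refine Finset.sum_congr rfl fun l _ => ?_
    rw [Finset.sum_comm]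
    simp [W, Matrix.mul_apply, Fintype.sum_prod_type, block_apply, Finset.sum_mul,
      apply_ite (starRingEnd ℂ), ite_mul, mul_ite]
  rw [this]
  exact Matrix.posSemidef_sum _ fun l _ => hX.conjTranspose_mul_mul_same _

theorem isSeparable_idTensor_of_mem_measurePrepare {Φ : MatMap d₁ d₂}
    (hΦ : Φ ∈ measurePrepare d₁ d₂) {X : TMat k d₁} (hX : X.PosSemidef) :
    IsSeparable (idTensor k Φ X) := by
  induction hΦ using AddSubmonoid.closure_induction with
  | mem Φ h =>
    obtain ⟨A, B, hA, hB, h⟩ := h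
    convert isSeparable_kronecker (posSemidef_trace_block hA hX) hB using 1
    ext p q
    simp [idTensor_apply, h, Matrix.kroneckerMap_apply]
  | zero => exact isSeparable_zero
  | add Φ Ψ _ _ h₁ h₂ => exact h₁.add h₂

theorem isEB_of_mem_measurePrepare {Φ : MatMap d₁ d₂} (hΦ : Φ ∈ measurePrepare d₁ d₂) : IsEB Φ :=
  fun _ _ _ hX => isSeparable_idTensor_of_mem_measurePrepare hΦ hX

/-- The vector `∑ i, eᵢ ⊗ eᵢ`. -/
def maxEntangled (d : ℕ) : Fin d × Fin d → ℂ := fun p => if p.1 = p.2 then 1 else 0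

theorem block_maxEntangled (d : ℕ) (i j : Fin d) :
    block (Matrix.vecMulVec (maxEntangled d) (star (maxEntangled d))) i j =
      Matrix.single i j 1 := by
  ext a b
  simp only [block_apply, Matrix.vecMulVec_apply, maxEntangled, Pi.star_apply, Matrix.single_apply]
  split_ifs <;> simp_all

/-- A separable decomposition `∑ Aₗ ⊗ Bₗ` of the Choi matrix gives `Φ(Eᵢⱼ) = ∑ Aₗ(i,j) Bₗ`. The
transpose on `Aₗ` comes from `∑ A(i,j) X(i,j) = tr(Aᵀ X)`. -/
theorem IsEB.mem_measurePrepare (hd : 1 ≤ d₁) {Φ : MatMap d₁ d₂} (h : IsEB Φ) :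
    Φ ∈ measurePrepare d₁ d₂ := by
  obtain ⟨n, A, B, hA, hB, hX⟩ :=
    h d₁ hd _ (Matrix.posSemidef_vecMulVec_self_star (maxEntangled d₁))
  have hΦ : Φ = ∑ i, traceMap (A i)ᵀ (B i) := by
    refine LinearMap.ext fun X => ?_
    ext a b
    have hsingle : ∀ i j, Φ (Matrix.single i j 1) a b = ∑ l, A l i j * B l a b := by
      intro i j
      have := congrFun (congrFun hX (i, a)) (j, b)
      rw [idTensor_apply, block_maxEntangled] at this
      simpa [Matrix.sum_apply, Matrix.kroneckerMap_apply] using this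
    conv_lhs => rw [Matrix.matrix_eq_sum_single X]
    have h1 : ∀ i j, Matrix.single i j (X i j) = X i j • Matrix.single i j (1 : ℂ) := by
      intro i j
      rw [Matrix.smul_single, smul_eq_mul, mul_one]
    simp only [h1, map_sum, map_smul, Matrix.sum_apply, Matrix.smul_apply, hsingle,
      LinearMap.sum_apply, traceMap_apply, Matrix.trace, Matrix.diag, Matrix.mul_apply,
      Matrix.transpose_apply, smul_eq_mul, Finset.mul_sum, Finset.sum_mul]
    rw [Finset.sum_comm' (t' := Finset.univ) (s' := fun _ => Finset.univ) (by simp)]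
    conv_rhs => rw [Finset.sum_comm]
    refine Finset.sum_congr rfl fun j _ => ?_
    rw [Finset.sum_comm]
    refine Finset.sum_congr rfl fun l _ => Finset.sum_congr rfl fun i _ => by ring
  rw [hΦ]
  exact AddSubmonoid.sum_mem _ fun i _ => traceMap_mem (hA i).transpose (hB i)

theorem comp_T_mem_measurePrepare {Φ : MatMap d₁ d₂} (hΦ : Φ ∈ measurePrepare d₁ d₂) :
    Φ ∘ₗ T d₁ ∈ measurePrepare d₁ d₂ := by
  induction hΦ using AddSubmonoid.closure_induction with
  | mem Φ h =>
    obtain ⟨A, B, hA, hB, h⟩ := h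
    refine AddSubmonoid.subset_closure ⟨Aᵀ, B, hA.transpose, hB, fun X => ?_⟩
    change Φ Xᵀ = _
    rw [h, ← Matrix.trace_transpose, Matrix.transpose_mul, Matrix.transpose_transpose,
      Matrix.trace_mul_comm]
  | zero => exact zero_mem _
  | add Φ Ψ _ _ h₁ h₂ => exact add_mem h₁ h₂

/-- The map `X ↦ V X Vᴴ`. -/
def conjMap (V : Matrix (Fin d₂) (Fin d₁) ℂ) : MatMap d₁ d₂ where
  toFun X := V * X * Vᴴ
  map_add' X Y := by rw [Matrix.mul_add, Matrix.add_mul]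
  map_smul' c X := by simp

theorem conjMap_apply (V : Matrix (Fin d₂) (Fin d₁) ℂ) (X : Mat d₁) :
    conjMap V X = V * X * Vᴴ := rfl

theorem conjMap_comp_mem_measurePrepare (V : Matrix (Fin d₃) (Fin d₂) ℂ) {Φ : MatMap d₁ d₂}
    (hΦ : Φ ∈ measurePrepare d₁ d₂) : conjMap V ∘ₗ Φ ∈ measurePrepare d₁ d₃ := by
  induction hΦ using AddSubmonoid.closure_induction with
  | mem Φ h =>
    obtain ⟨A, B, hA, hB, h⟩ := h
    exact AddSubmonoid.subset_closure ⟨A, V * B * Vᴴ, hA, hB.mul_mul_conjTranspose_same V,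
      fun X => by simp [conjMap_apply, h]⟩
  | zero =>
    rw [LinearMap.comp_zero]
    exact zero_mem _
  | add Φ Ψ _ _ h₁ h₂ =>
    rw [LinearMap.comp_add]
    exact add_mem h₁ h₂

/-- For rank-one `A = v v*` and `B = w w*`, `tr(A X) B` has the single Kraus operator `v w*`. -/
theorem isKPEB_one_of_mem_measurePrepare {Φ : MatMap d₁ d₂} (hΦ : Φ ∈ measurePrepare d₁ d₂) :
    IsKPEB 1 Φ := by
  induction hΦ using AddSubmonoid.closure_induction with
  | mem Φ h =>
    obtain ⟨A, B, hA, hB, h⟩ := h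
    obtain ⟨m, v, rfl⟩ := Matrix.posSemidef_iff_eq_sum_vecMulVec.1 hA
    obtain ⟨n, w, rfl⟩ := Matrix.posSemidef_iff_eq_sum_vecMulVec.1 hB
    let e := finProdFinEquiv (m := m) (n := n)
    let V : Fin m × Fin n → Matrix (Fin d₁) (Fin d₂) ℂ :=
      fun i => Matrix.vecMulVec (v i.1) (star (w i.2))
    refine ⟨m * n, fun i => V (e.symm i), fun i => Matrix.rank_vecMulVec_le _ _, fun X => ?_⟩
    rw [Equiv.sum_comp e.symm (fun i => (V i)ᴴ * X * V i), Fintype.sum_prod_type, h, Finset.sum_mul,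
      Matrix.trace_sum, Finset.sum_smul]
    refine Finset.sum_congr rfl fun i _ => ?_
    rw [Finset.smul_sum]
    refine Finset.sum_congr rfl fun j _ => ?_
    ext a b
    simp only [trace_vecMulVec_mul, V, Matrix.mul_apply, Matrix.conjTranspose_apply,
      Matrix.vecMulVec_apply, Matrix.smul_apply, smul_eq_mul, Finset.sum_mul, Pi.star_apply,
      star_mul', star_star]
    rw [Finset.sum_comm]
    exact Finset.sum_congr rfl fun x _ => Finset.sum_congr rfl fun y _ => by ring
  | zero => exact ⟨0, Fin.elim0, fun i => i.elim0, fun X => by simp⟩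
  | add Φ Ψ _ _ h₁ h₂ =>
    obtain ⟨m, V, hV, hΦ⟩ := h₁
    obtain ⟨n, W, hW, hΨ⟩ := h₂
    refine ⟨m + n, Fin.append V W, fun i => ?_, fun X => ?_⟩
    · refine Fin.addCases (fun i => ?_) (fun i => ?_) i
      · simpa using hV i
      · simpa using hW i
    · simp [Fin.sum_univ_add, hΦ, hΨ]

end EntanglementBreaking

/-! ### Closed cones and mapping cones. -/

section Cones

variable {k d₁ d₂ : ℕ}

/-- A common form of `EB`, `EBk` and `CP`: `s` collects the amplification levels that are tested,
`S` the target cone at each level. -/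
theorem isClosedConvexCone_of_idTensor (s : Set ℕ) (S : ∀ k, Set (TMat k d₂))
    (h0 : ∀ k, 0 ∈ S k) (hadd : ∀ k, ∀ X ∈ S k, ∀ Y ∈ S k, X + Y ∈ S k)
    (hsmul : ∀ k, ∀ c : ℝ, 0 ≤ c → ∀ X ∈ S k, c • X ∈ S k) (hS : ∀ k, IsClosed (S k)) :
    IsClosedConvexCone {Φ : MatMap d₁ d₂ | ∀ k ∈ s, ∀ X : TMat k d₁, X.PosSemidef →
      idTensor k Φ X ∈ S k} where
  zero_mem := fun k _ X _ => h0 k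
  add_mem := fun Φ hΦ Ψ hΨ k hk X hX => hadd k _ (hΦ k hk X hX) _ (hΨ k hk X hX)
  smul_mem := fun c hc Φ hΦ k hk X hX => by
    rw [idTensor_smul]
    exact hsmul k c hc _ (hΦ k hk X hX)
  isClosed := by
    simp only [Set.ofPred_forall]
    let _ := mapTopology d₁ d₂
    exact isClosed_iInter fun k => isClosed_iInter fun _ => isClosed_iInter fun X =>
      isClosed_iInter fun _ => isClosed_setOf_idTensor_mem (hS k) X

theorem isClosedConvexCone_EB : IsClosedConvexCone (EB d₁ d₂) :=
  isClosedConvexCone_of_idTensor (Set.Ici 1) (fun _ => {X | IsSeparable X})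
    (fun _ => isSeparable_zero) (fun _ _ hX _ hY => IsSeparable.add hX hY)
    (fun _ _ hc _ hX => IsSeparable.smul hX hc) fun _ => isClosed_isSeparable

theorem isClosedConvexCone_EBk : IsClosedConvexCone (EBk k d₁ d₂) := by
  have h := isClosedConvexCone_of_idTensor (d₁ := d₁) {k} (fun k => {X : TMat k d₂ | IsSeparable X})
    (fun _ => isSeparable_zero) (fun _ _ hX _ hY => IsSeparable.add hX hY)
    (fun _ _ hc _ hX => IsSeparable.smul hX hc) fun _ => isClosed_isSeparable
  convert! h using 1
  ext Φ
  simp [EBk, isKEB_iff]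

theorem isClosedConvexCone_CP : IsClosedConvexCone (CP d₁ d₂) :=
  isClosedConvexCone_of_idTensor (Set.Ici 1) (fun _ => {X | X.PosSemidef})
    (fun _ => Matrix.PosSemidef.zero) (fun _ _ hX _ hY => Matrix.PosSemidef.add hX hY)
    (fun _ _ hc _ hX => Matrix.PosSemidef.smul hX hc) fun _ => isClosed_posSemidef

theorem IsClosedConvexCone.inter {C₁ C₂ : Set (MatMap d₁ d₂)} (h₁ : IsClosedConvexCone C₁)
    (h₂ : IsClosedConvexCone C₂) : IsClosedConvexCone (C₁ ∩ C₂) where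
  zero_mem := ⟨h₁.zero_mem, h₂.zero_mem⟩
  add_mem := fun Φ hΦ Ψ hΨ => ⟨h₁.add_mem Φ hΦ.1 Ψ hΨ.1, h₂.add_mem Φ hΦ.2 Ψ hΨ.2⟩
  smul_mem := fun c hc Φ hΦ => ⟨h₁.smul_mem c hc Φ hΦ.1, h₂.smul_mem c hc Φ hΦ.2⟩
  isClosed := by
    let _ := mapTopology d₁ d₂
    exact IsClosed.inter h₁.isClosed h₂.isClosed

theorem isMappingCone_EBk (hk : 1 ≤ k) : IsMappingCone (EBk k d₁ d₂) where
  closedConvexCone := isClosedConvexCone_EBk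
  subset_P := fun _ hΦ => hΦ.1.isPositive hk
  comp_mem := fun _ hΘ _ hΨ _ hΦ => isKEB_iff.2 fun X hX =>
    idTensor_separable hΦ.isPositive (hΘ.2 _ (hΨ k hk X hX))

theorem isMappingCone_EBCPk (hk : 1 ≤ k) : IsMappingCone (EBCPk k d₁ d₂) where
  closedConvexCone := isClosedConvexCone_EBk.inter isClosedConvexCone_CP
  subset_P := fun _ hΦ => hΦ.1.1.isPositive hk
  comp_mem := fun Θ hΘ Ψ hΨ Φ hΦ =>
    ⟨(isMappingCone_EBk hk).comp_mem Θ hΘ.1 Ψ hΨ Φ hΦ, IsCP.comp hΦ (IsCP.comp hΘ.2 hΨ)⟩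

end Cones

/-! ### The dichotomy for typical cones. -/

section Typical

variable {d₁ d₂ : ℕ}

theorem comp_T_comp_T (Φ : MatMap d₁ d₂) : (Φ ∘ₗ T d₁) ∘ₗ T d₁ = Φ :=
  LinearMap.ext fun X => by
    change Φ Xᵀᵀ = _
    rw [Matrix.transpose_transpose]

theorem mem_compT_iff {C : Set (MatMap d₁ d₂)} {Φ : MatMap d₁ d₂} :
    Φ ∈ compT C ↔ Φ ∘ₗ T d₁ ∈ C := by
  constructor
  · rintro ⟨Ψ, hΨ, rfl⟩
    simpa only [comp_T_comp_T] using hΨ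
  · exact fun h => ⟨_, h, comp_T_comp_T Φ⟩

theorem IsEB.comp_T (hd : 1 ≤ d₁) {Φ : MatMap d₁ d₂} (h : IsEB Φ) : IsEB (Φ ∘ₗ T d₁) :=
  isEB_of_mem_measurePrepare (comp_T_mem_measurePrepare (h.mem_measurePrepare hd))

theorem compT_EB (hd : 1 ≤ d₁) : compT (EB d₁ d₂) = EB d₁ d₂ := by
  ext Φ
  rw [mem_compT_iff]
  refine ⟨fun h => ?_, fun h => IsEB.comp_T hd h⟩
  have := IsEB.comp_T hd h
  rwa [comp_T_comp_T] at this

theorem subset_join_left (C₁ C₂ : Set (MatMap d₁ d₂)) : C₁ ⊆ join C₁ C₂ :=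
  Set.subset_sInter fun _ hK => Set.subset_union_left.trans hK.2

theorem subset_join_right (C₁ C₂ : Set (MatMap d₁ d₂)) : C₂ ⊆ join C₁ C₂ :=
  Set.subset_sInter fun _ hK => Set.subset_union_right.trans hK.2

theorem join_self {C : Set (MatMap d₁ d₂)} (hC : IsClosedConvexCone C) : join C C = C :=
  Set.Subset.antisymm (Set.sInter_subset_of_mem ⟨hC, (Set.union_self C).le⟩)
    (subset_join_left C C)

/-- A typical cone contains the entanglement breaking maps, and unless it consists of them only, it
contains all maps that are `2`-partially entanglement breaking together with their composition
with the transpose map. -/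
theorem IsTypical.eq_EB_or_subset (hd : 1 ≤ d₁) {C : Set (MatMap d₁ d₂)} (hC : IsTypical C) :
    EB d₁ d₂ ⊆ C ∧ (C = EB d₁ d₂ ∨ PEBk 2 d₁ d₂ ∩ compT (PEBk 2 d₁ d₂) ⊆ C) := by
  induction hC with
  | pos =>
    exact ⟨fun Φ h => (IsEB.isCP h).isPositive, Or.inr fun Φ h => (IsKPEB.isCP h.1).isPositive⟩
  | kPos j hj =>
    exact ⟨fun Φ h => IsEB.isCP h j hj.le, Or.inr fun Φ h => IsKPEB.isCP h.1 j hj.le⟩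
  | cp => exact ⟨fun Φ h => IsEB.isCP h, Or.inr fun Φ h => IsKPEB.isCP h.1⟩
  | kPEB j hj =>
    exact ⟨fun Φ h => (isKPEB_one_of_mem_measurePrepare (IsEB.mem_measurePrepare hd h)).mono hj.le,
      Or.inr fun Φ h => IsKPEB.mono hj h.1⟩
  | eb => exact ⟨subset_rfl, Or.inl rfl⟩
  | transpose C _ ih =>
    refine ⟨fun Φ h => mem_compT_iff.2 (ih.1 (IsEB.comp_T hd h)), ih.2.imp ?_ ?_⟩
    · rintro rfl
      exact compT_EB hd
    · intro h Φ hΦ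
      -- Composition with `T` exchanges the two sets of the intersection.
      refine mem_compT_iff.2 (h ⟨mem_compT_iff.1 hΦ.2, mem_compT_iff.2 ?_⟩)
      rw [comp_T_comp_T]
      exact hΦ.1
  | inter C₁ C₂ _ _ ih₁ ih₂ =>
    refine ⟨Set.subset_inter ih₁.1 ih₂.1, ?_⟩
    -- `EB` is the least typical cone, so a meet with it is `EB` again.
    rcases ih₁.2 with rfl | h₁
    · exact Or.inl (Set.inter_eq_left.2 ih₂.1)
    · rcases ih₂.2 with rfl | h₂
      · exact Or.inl (Set.inter_eq_right.2 ih₁.1)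
      · exact Or.inr (Set.subset_inter h₁ h₂)
  | join C₁ C₂ _ _ ih₁ ih₂ =>
    refine ⟨ih₁.1.trans (subset_join_left _ _), ?_⟩
    rcases ih₁.2 with rfl | h₁
    · rcases ih₂.2 with rfl | h₂
      · exact Or.inl (join_self isClosedConvexCone_EB)
      · exact Or.inr (h₂.trans (subset_join_right _ _))
    · exact Or.inr (h₁.trans (subset_join_left _ _))

end Typical

/-! ### The map `X ↦ k tr(X) 1 - Xᵀ`. -/

section TransposedReduction

variable {k d r : ℕ}

/-- The map `X ↦ k tr(X) 1 - Xᵀ`. -/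
noncomputable def transposedReduction (k d : ℕ) : MatMap d d :=
  traceMap ((k : ℂ) • 1) 1 - T d

theorem transposedReduction_apply (k d : ℕ) (X : Mat d) :
    transposedReduction k d X = (k * X.trace) • (1 : Mat d) - Xᵀ := by
  change ((k : ℂ) • (1 : Mat d) * X).trace • (1 : Mat d) - Xᵀ = _
  simp

theorem traceMap_natCast_mem {d₁ d₂ : ℕ} (n : ℕ) {B : Mat d₂} (hB : B.PosSemidef) :
    traceMap ((n : ℂ) • (1 : Mat d₁)) B ∈ measurePrepare d₁ d₂ :=
  traceMap_mem (Matrix.PosSemidef.one.smul (Nat.cast_nonneg n)) hB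

/-- The vector `eᵢ + c eⱼ`. -/
noncomputable def twoLevel (i j : Fin r) (c : ℂ) : Fin r → ℂ := Pi.single i 1 + c • Pi.single j 1

theorem vecMulVec_twoLevel (i j : Fin r) (c : ℂ) :
    Matrix.vecMulVec (twoLevel i j c) (star (twoLevel i j c)) =
      Matrix.single i i 1 + star c • Matrix.single i j 1 + c • Matrix.single j i 1 +
        (c * star c) • Matrix.single j j (1 : ℂ) := by
  have hs : ∀ l a : Fin r, star ((Pi.single l 1 : Fin r → ℂ) a) = (Pi.single l 1 : Fin r → ℂ) a := by
    intro l a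
    rw [Pi.single_apply]
    split_ifs <;> simp
  simp only [Matrix.single_eq_single_vecMulVec_single]
  ext a b
  simp only [Matrix.vecMulVec_apply, twoLevel, Pi.add_apply, Pi.star_apply, Pi.smul_apply,
    Matrix.add_apply, Matrix.smul_apply, star_add, star_mul', smul_eq_mul, hs]
  ring

theorem trace_single_mul (i j : Fin r) (X : Mat r) :
    (Matrix.single i j 1 * X).trace = X j i := by
  rw [Matrix.trace_mul_comm, Matrix.trace_mul_single]
  simp

theorem trace_twoLevel_mul (i j : Fin r) (c : ℂ) (X : Mat r) :
    (Matrix.vecMulVec (twoLevel i j c) (star (twoLevel i j c)) * X).trace =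
      X i i + star c * X j i + c * X i j + c * star c * X j j := by
  simp only [vecMulVec_twoLevel, add_mul, Matrix.trace_add, Matrix.smul_mul, Matrix.trace_smul,
    trace_single_mul, smul_eq_mul]

/-- The twirl of a product of two orthogonal vectors in the plane of `eᵢ` and `eⱼ`. -/
noncomputable def pairMap (i j : Fin r) : MatMap r r :=
  ∑ l : Fin 4, traceMap (((1 / 8 : ℝ) : ℂ) • Matrix.vecMulVec (twoLevel i j (Complex.I ^ (l : ℕ)))
      (star (twoLevel i j (Complex.I ^ (l : ℕ)))))
    (Matrix.vecMulVec (twoLevel i j (-star (Complex.I ^ (l : ℕ))))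
      (star (twoLevel i j (-star (Complex.I ^ (l : ℕ))))))

theorem pairMap_mem (i j : Fin r) : pairMap i j ∈ measurePrepare r r :=
  AddSubmonoid.sum_mem _ fun l _ => traceMap_mem
    ((Matrix.posSemidef_vecMulVec_self_star _).smul (by
      rw [Complex.zero_le_real]
      norm_num)) (Matrix.posSemidef_vecMulVec_self_star _)

/-- The phases `c` run over the fourth roots of unity, so all terms with a factor `c`, `c²` or their
conjugates average to zero. -/
theorem pairMap_apply (i j : Fin r) (X : Mat r) :
    pairMap i j X = (1 / 2 : ℂ) • ((X i i + X j j) • (Matrix.single i i 1 + Matrix.single j j 1) -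
      X i j • Matrix.single j i 1 - X j i • Matrix.single i j 1) := by
  have h3 : Complex.I ^ 3 = -Complex.I := by
    rw [pow_succ, Complex.I_sq]
    ring
  simp only [pairMap, LinearMap.sum_apply, traceMap_apply, Matrix.smul_mul, Matrix.trace_smul,
    trace_twoLevel_mul]
  simp only [vecMulVec_twoLevel, Fin.sum_univ_four]
  ext a b
  generalize Matrix.single i i (1 : ℂ) = E
  generalize Matrix.single i j (1 : ℂ) = F
  generalize Matrix.single j i (1 : ℂ) = G
  generalize Matrix.single j j (1 : ℂ) = H
  simp only [Fin.val_zero, Fin.val_one, Fin.val_two, show ((3 : Fin 4) : ℕ) = 3 from rfl, pow_zero,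
    pow_one, Complex.I_sq, h3, Matrix.add_apply, Matrix.sub_apply, Matrix.smul_apply, smul_eq_mul,
    star_one, star_neg, Complex.star_def, Complex.conj_I]
  push_cast
  ring_nf
  simp only [Complex.I_sq, Complex.I_pow_four]
  ring

theorem sum_sum_smul (c : ℂ) (f : Fin r → Fin r → Mat r) :
    ∑ i, ∑ j, c • f i j = c • ∑ i, ∑ j, f i j := by
  simp only [Finset.smul_sum]

theorem sum_diag_smul_single (X : Mat r) :
    ∑ i, ∑ j, X i i • Matrix.single j j (1 : ℂ) = X.trace • (1 : Mat r) := by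
  rw [← Matrix.sum_single_one, Matrix.trace, Finset.sum_smul]
  exact Finset.sum_congr rfl fun i _ => (Finset.smul_sum).symm

theorem sum_smul_single_swap (X : Mat r) :
    ∑ i, ∑ j, X i j • Matrix.single j i (1 : ℂ) = Xᵀ := by
  rw [Finset.sum_comm, Matrix.matrix_eq_sum_single Xᵀ]
  refine Finset.sum_congr rfl fun i _ => Finset.sum_congr rfl fun j _ => ?_
  rw [Matrix.smul_single, smul_eq_mul, mul_one, Matrix.transpose_apply]

theorem sum_diag_smul_single' (X : Mat r) :
    ∑ i, ∑ j, X j j • Matrix.single i i (1 : ℂ) = X.trace • (1 : Mat r) := by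
  rw [Finset.sum_comm, sum_diag_smul_single]

theorem sum_smul_single_swap' (X : Mat r) :
    ∑ i, ∑ j, X j i • Matrix.single i j (1 : ℂ) = Xᵀ := by
  rw [Finset.sum_comm, sum_smul_single_swap]

/-- Summed over `i ≠ j`, the maps `pairMap i j` produce the off-diagonal part of `-Xᵀ`, the diagonal
terms `(r - 1) Xᵢᵢ Eᵢᵢ`, and each `Xᵢᵢ Eⱼⱼ` once. The `r - 1` missing copies of the latter are
measure-and-prepare. -/
theorem transposedReduction_self_mem (r : ℕ) : transposedReduction r r ∈ measurePrepare r r := by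
  rcases r.eq_zero_or_pos with rfl | hr
  · have : transposedReduction 0 0 = 0 := LinearMap.ext fun X => by
      ext a
      exact a.elim0
    rw [this]
    exact zero_mem _
  have hE : ∀ i : Fin r, (Matrix.single i i (1 : ℂ)).PosSemidef := by
    intro i
    rw [Matrix.single_eq_single_vecMulVec_single]
    convert! Matrix.posSemidef_vecMulVec_self_star (Pi.single i (1 : ℂ))
    simp
  have key : transposedReduction r r = ∑ i, ∑ j ∈ Finset.univ.erase i,
      (pairMap i j + (r - 1) • traceMap (Matrix.single i i 1) (Matrix.single j j 1)) := by
    refine LinearMap.ext fun X => ?_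
    have hcast : ((r - 1 : ℕ) : ℂ) = r - 1 := by
      rw [Nat.cast_sub hr, Nat.cast_one]
    have hF : ∀ i j, (pairMap i j + (r - 1) • traceMap (Matrix.single i i 1)
        (Matrix.single j j 1)) X = (1 / 2 : ℂ) • (X i i • Matrix.single i i (1 : ℂ)) +
          (r - 1 / 2 : ℂ) • (X i i • Matrix.single j j (1 : ℂ)) +
          (1 / 2 : ℂ) • (X j j • Matrix.single i i (1 : ℂ)) +
          (1 / 2 : ℂ) • (X j j • Matrix.single j j (1 : ℂ)) -
          (1 / 2 : ℂ) • (X i j • Matrix.single j i (1 : ℂ)) -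
          (1 / 2 : ℂ) • (X j i • Matrix.single i j (1 : ℂ)) := by
      intro i j
      rw [LinearMap.add_apply, LinearMap.smul_apply, pairMap_apply, traceMap_apply,
        trace_single_mul, ← Nat.cast_smul_eq_nsmul ℂ, hcast]
      module
    -- The diagonal terms are subtracted below, to turn sums over `j ≠ i` into full sums.
    have hD : ∀ i, (pairMap i i + (r - 1) • traceMap (Matrix.single i i 1)
        (Matrix.single i i 1)) X = (r : ℂ) • (X i i • Matrix.single i i (1 : ℂ)) := by
      intro i
      rw [hF]
      module
    simp only [LinearMap.sum_apply]
    simp only [Finset.sum_erase_eq_sub (Finset.mem_univ _), hD]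
    simp only [hF]
    simp only [Finset.sum_add_distrib, Finset.sum_sub_distrib, sum_sum_smul,
      sum_diag_smul_single, sum_diag_smul_single', sum_smul_single_swap, sum_smul_single_swap',
      Finset.sum_const, Finset.card_univ, Fintype.card_fin, ← Nat.cast_smul_eq_nsmul ℂ,
      transposedReduction_apply]
    simp only [← Finset.smul_sum]
    module
  rw [key]
  exact AddSubmonoid.sum_mem _ fun i _ => AddSubmonoid.sum_mem _ fun j _ =>
    add_mem (pairMap_mem i j) (AddSubmonoid.nsmul_mem _ (traceMap_mem (hE i) (hE j)) _)

/-- Transposition turns `U` into its conjugate `V`. On the range of `V` the map is `r tr(X) 1 - Xᵀ`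
plus a surplus `(k - r) tr(X)`; on the complement it is `k tr(X)`. -/
theorem transposedReduction_comp_conjMap_mem (hr : r ≤ k) {U : Matrix (Fin d) (Fin r) ℂ}
    (hU : Uᴴ * U = 1) : transposedReduction k d ∘ₗ conjMap U ∈ measurePrepare r d := by
  let V : Matrix (Fin d) (Fin r) ℂ := Uᴴᵀ
  have hVH : Vᴴ = Uᵀ := by
    ext a b
    simp [V]
  have hV : Vᴴ * V = 1 := by
    rw [hVH, ← Matrix.transpose_mul, hU, Matrix.transpose_one]
  have hQ : (1 - V * Vᴴ).PosSemidef := by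
    convert! Matrix.posSemidef_conjTranspose_mul_self (1 - V * Vᴴ) using 1
    have h1 : V * Vᴴ * (V * Vᴴ) = V * Vᴴ := by
      rw [Matrix.mul_assoc, ← Matrix.mul_assoc Vᴴ, hV, Matrix.one_mul]
    rw [Matrix.conjTranspose_sub, Matrix.conjTranspose_one, Matrix.conjTranspose_mul,
      Matrix.conjTranspose_conjTranspose, mul_sub, sub_mul, sub_mul, h1]
    simp
  have key : transposedReduction k d ∘ₗ conjMap U = conjMap V ∘ₗ transposedReduction r r +
      traceMap (((k - r : ℕ) : ℂ) • 1) (V * Vᴴ) + traceMap ((k : ℂ) • 1) (1 - V * Vᴴ) := by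
    refine LinearMap.ext fun X => ?_
    have htr : (U * X * Uᴴ).trace = X.trace := by
      rw [Matrix.trace_mul_comm, ← Matrix.mul_assoc, hU, Matrix.one_mul]
    have htp : (U * X * Uᴴ)ᵀ = V * Xᵀ * Vᴴ := by
      rw [hVH, Matrix.transpose_mul, Matrix.transpose_mul, ← Matrix.mul_assoc]
    simp only [LinearMap.add_apply, LinearMap.comp_apply, conjMap_apply, transposedReduction_apply,
      traceMap_apply, htr, htp, Matrix.smul_mul, Matrix.one_mul, Matrix.trace_smul, smul_eq_mul,
      Matrix.mul_sub, Matrix.sub_mul, Matrix.mul_smul, Matrix.mul_one, Nat.cast_sub hr]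
    module
  rw [key]
  exact add_mem (add_mem (conjMap_comp_mem_measurePrepare V (transposedReduction_self_mem r))
    (traceMap_natCast_mem _ (Matrix.posSemidef_self_mul_conjTranspose V)))
    (traceMap_natCast_mem _ hQ)

/-- A vector of `ℂᵏ ⊗ ℂᵈ` lies in `ℂᵏ ⊗ E` for a subspace `E` of dimension at most `k`. -/
theorem exists_isometry_of_vec (v : Fin k × Fin d → ℂ) :
    ∃ (r : ℕ) (U : Matrix (Fin d) (Fin r) ℂ) (w : Fin k × Fin r → ℂ), r ≤ k ∧ Uᴴ * U = 1 ∧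
      ∀ i a, v (i, a) = ∑ l, U a l * w (i, l) := by
  let x : Fin k → EuclideanSpace ℂ (Fin d) := fun i => WithLp.toLp 2 fun a => v (i, a)
  let S := Submodule.span ℂ (Set.range x)
  let b := stdOrthonormalBasis ℂ S
  have hx : ∀ i, x i ∈ S := fun i => Submodule.subset_span ⟨i, rfl⟩
  refine ⟨Module.finrank ℂ S, Matrix.of fun a l => (b l : EuclideanSpace ℂ (Fin d)) a,
    fun p => b.repr ⟨x p.1, hx p.1⟩ p.2, ?_, ?_, fun i a => ?_⟩
  · exact (finrank_range_le_card (R := ℂ) x).trans (Fintype.card_fin k).le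
  · ext l m
    have h := orthonormal_iff_ite.1 b.orthonormal l m
    rw [Submodule.coe_inner, PiLp.inner_apply] at h
    rw [Matrix.one_apply, ← h]
    simp [Matrix.mul_apply, mul_comm]
  · have h := congrArg (fun y : S => (y : EuclideanSpace ℂ (Fin d)) a) (b.sum_repr ⟨x i, hx i⟩)
    simp only [Submodule.coe_sum, Submodule.coe_smul, WithLp.ofLp_sum, WithLp.ofLp_smul,
      Finset.sum_apply, Pi.smul_apply, smul_eq_mul] at h
    exact h.symm.trans (Finset.sum_congr rfl fun l _ => mul_comm _ _)

/-- A rank-one input factors through `ℂᵏ ⊗ ℂʳ` with `r ≤ k`, where the map is measure-and-prepare.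
-/
theorem isKEB_transposedReduction (k d : ℕ) : IsKEB k (transposedReduction k d) := by
  refine isKEB_iff.2 fun X hX => ?_
  obtain ⟨m, v, rfl⟩ := Matrix.posSemidef_iff_eq_sum_vecMulVec.1 hX
  rw [idTensor_sum_right]
  refine isSeparable_sum _ _ fun l _ => ?_
  obtain ⟨r, U, w, hr, hU, hv⟩ := exists_isometry_of_vec (v l)
  convert! isSeparable_idTensor_of_mem_measurePrepare
    (transposedReduction_comp_conjMap_mem hr hU) (Matrix.posSemidef_vecMulVec_self_star w) using 1
  rw [idTensor_comp]
  congr 1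
  ext p q
  obtain ⟨i, a⟩ := p
  obtain ⟨j, b⟩ := q
  simp only [idTensor_apply, conjMap_apply, Matrix.vecMulVec_apply, Pi.star_apply, hv,
    Matrix.mul_apply, block_apply, Matrix.conjTranspose_apply, star_sum, star_mul', Finset.sum_mul,
    Finset.mul_sum]
  refine Finset.sum_congr rfl fun x _ => Finset.sum_congr rfl fun y _ => by ring

/-- `tr(X) 1 - Xᵀ` is half the sum of the compressions by the antisymmetric matrices `Eᵢⱼ - Eⱼᵢ`;
the rest is `(k - 1) tr(X) 1`. -/
theorem isCP_transposedReduction (hk : 1 ≤ k) : IsCP (transposedReduction k d) := by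
  let W : Fin d × Fin d → Mat d := fun p => Matrix.single p.1 p.2 1 - Matrix.single p.2 p.1 1
  let Ψ : MatMap d d := ∑ p, conjMap (W p)ᴴ
  have hΨ : IsCP Ψ := isCP_of_kraus W fun X => by
    simp only [Ψ, LinearMap.sum_apply, conjMap_apply, Matrix.conjTranspose_conjTranspose]
  have key : transposedReduction k d = traceMap (((k - 1 : ℕ) : ℂ) • 1) 1 +
      ((1 / 2 : ℝ) : ℂ) • Ψ := by
    refine LinearMap.ext fun X => ?_
    have hW : ∀ p, conjMap (W p)ᴴ X = X p.1 p.1 • Matrix.single p.2 p.2 1 -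
        X p.1 p.2 • Matrix.single p.2 p.1 1 - X p.2 p.1 • Matrix.single p.1 p.2 1 +
          X p.2 p.2 • Matrix.single p.1 p.1 (1 : ℂ) := by
      intro p
      simp only [W, conjMap_apply, Matrix.conjTranspose_sub, Matrix.conjTranspose_single, star_one,
        Matrix.sub_mul, Matrix.mul_sub, Matrix.single_mul_mul_single, Matrix.smul_single,
        smul_eq_mul, one_mul, mul_one]
      abel
    simp only [transposedReduction_apply, LinearMap.add_apply, LinearMap.smul_apply, Ψ,
      LinearMap.sum_apply, hW, traceMap_apply, Nat.cast_sub hk, Fintype.sum_prod_type,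
      Finset.sum_add_distrib, Finset.sum_sub_distrib, sum_diag_smul_single, sum_diag_smul_single',
      sum_smul_single_swap, sum_smul_single_swap', Matrix.smul_mul, Matrix.one_mul,
      Matrix.trace_smul, smul_eq_mul]
    push_cast
    module
  rw [key]
  exact isClosedConvexCone_CP.add_mem _ (isEB_of_mem_measurePrepare
    (traceMap_natCast_mem _ Matrix.PosSemidef.one)).isCP _
    (isClosedConvexCone_CP.smul_mem _ (by norm_num) _ hΨ)

/-- The swap is an entanglement witness: its expectation in `x ⊗ y` is `|⟨x, y⟩|²`. -/
theorem IsSeparable.swap_nonneg {X : TMat d d} (hX : IsSeparable X) :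
    0 ≤ ∑ i, ∑ j, X (i, j) (j, i) := by
  obtain ⟨ι, _, x, y, rfl⟩ := isSeparable_iff_exists_vec.1 hX
  have : ∑ i, ∑ j, (∑ l, Matrix.vecMulVec (x l) (star (x l)) ⊗ₖ
      Matrix.vecMulVec (y l) (star (y l))) (i, j) (j, i) =
      ∑ l, (∑ i, x l i * star (y l i)) * star (∑ i, x l i * star (y l i)) := by
    simp only [Matrix.sum_apply, Matrix.kroneckerMap_apply, Matrix.vecMulVec_apply, Pi.star_apply,
      star_sum, star_mul', star_star, Finset.sum_mul_sum]
    symm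
    rw [Finset.sum_comm]
    refine Finset.sum_congr rfl fun i _ => ?_
    rw [Finset.sum_comm]
    exact Finset.sum_congr rfl fun j _ => Finset.sum_congr rfl fun l _ => by ring
  rw [this]
  exact Finset.sum_nonneg fun l _ => mul_star_self_nonneg _

theorem not_isEB_transposedReduction (hkd : k < d) : ¬ IsEB (transposedReduction k d) := by
  intro h
  have h1 := (h d (by omega) _
    (Matrix.posSemidef_vecMulVec_self_star (maxEntangled d))).swap_nonneg
  have h2 : ∀ i j : Fin d, transposedReduction k d (Matrix.single i j 1) j i =
      (if i = j then (k : ℂ) else 0) - 1 := by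
    intro i j
    rw [transposedReduction_apply]
    by_cases hij : i = j
    · subst hij
      simp
    · simp [hij, Matrix.trace_single_eq_of_ne]
  simp only [idTensor_apply, block_maxEntangled, h2, Finset.sum_sub_distrib, Finset.sum_ite_eq,
    Finset.mem_univ, if_true, Finset.sum_const, Finset.card_univ, Fintype.card_fin, nsmul_eq_mul,
    mul_one] at h1
  have h3 : (0 : ℝ) ≤ d * k - d * d := by
    rw [← Complex.zero_le_real]
    push_cast
    exact h1
  have hkd' : (k : ℝ) < d := by exact_mod_cast hkd
  have hd : (0 : ℝ) < d := lt_of_le_of_lt (Nat.cast_nonneg k) hkd'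
  nlinarith

end TransposedReduction

/-! ### The Horodecki state and the range criterion. -/

section Horodecki

/-- Five vectors in `ℂ² ⊗ ℂ⁴` that span the range of a positive matrix whose partial transpose is
positive, the entangled state of P. Horodecki in dimension `2 × 4`. -/
def horodeckiVec : Fin 5 → Matrix (Fin 2) (Fin 4) ℤ :=
  ![!![4, 0, 0, 0; 0, 4, 0, 0], !![0, 4, 0, 0; 0, 0, 4, 0], !![0, 0, 4, 0; 0, 0, 0, 4],
    !![0, 0, 0, 4; 0, 0, 0, 0], !![0, 0, 0, 0; 5, 0, 0, 3]]

/-- Five vectors that span the range of the partial transpose of the same matrix. -/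
def horodeckiVecT : Fin 5 → Matrix (Fin 2) (Fin 4) ℤ :=
  ![!![0, 4, 0, 0; 4, 0, 0, 0], !![0, 0, 4, 0; 0, 4, 0, 0], !![0, 0, 0, 4; 0, 0, 4, 0],
    !![4, 0, 0, 0; 0, 0, 0, 0], !![0, 0, 0, 0; 3, 0, 0, 5]]

/-- Horodecki's parameter is `b = 8/17`, up to scaling; the triple `8, 15, 17` makes `√(1 - b²)`
rational and the vectors integral. -/
theorem horodecki_partialTranspose : ∀ (p q : Fin 2) (a b : Fin 4),
    ∑ l, horodeckiVec l q a * horodeckiVec l p b =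
      ∑ l, horodeckiVecT l p a * horodeckiVecT l q b := by
  decide

/-- A product vector that occurs in a decomposition of a positive matrix is orthogonal to the
kernel of this matrix. -/
theorem sum_mul_eq_zero_of_orthogonal {ι : Type*} [Fintype ι] {m n r : ℕ} (x : ι → Fin m → ℂ)
    (y : ι → Fin n → ℂ) (V : Fin r → Matrix (Fin m) (Fin n) ℤ)
    (h : ∀ p q a b, ∑ i, x i p * star (x i q) * (y i a * star (y i b)) =
      ∑ l, (V l p a : ℂ) * V l q b)
    (φ : Matrix (Fin m) (Fin n) ℤ) (hφ : ∀ l, ∑ p, ∑ a, φ p a * V l p a = 0) (i : ι) :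
    ∑ p, ∑ a, (φ p a : ℂ) * (x i p * y i a) = 0 := by
  -- Both decompositions compute the quadratic form of the matrix at `φ`: a sum of squares on one
  -- side, zero on the other.
  have key : ∑ i, (∑ p, ∑ a, (φ p a : ℂ) * (x i p * y i a)) *
      star (∑ p, ∑ a, (φ p a : ℂ) * (x i p * y i a)) = 0 := by
    calc _ = ∑ p, ∑ a, ∑ q, ∑ b, (φ p a : ℂ) * φ q b *
          ∑ i, x i q * star (x i p) * (y i b * star (y i a)) := by
          simp only [star_sum, Finset.sum_mul, Finset.mul_sum, star_mul', star_intCast]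
          rw [Finset.sum_comm]
          refine Finset.sum_congr rfl fun p _ => ?_
          rw [Finset.sum_comm]
          refine Finset.sum_congr rfl fun a _ => ?_
          rw [Finset.sum_comm]
          refine Finset.sum_congr rfl fun q _ => ?_
          rw [Finset.sum_comm]
          refine Finset.sum_congr rfl fun b _ => Finset.sum_congr rfl fun i _ => by ring
      _ = ∑ l, (∑ p, ∑ a, (φ p a : ℂ) * V l p a) * ∑ q, ∑ b, (φ q b : ℂ) * V l q b := by
          simp only [h, Finset.sum_mul, Finset.mul_sum]
          symm
          rw [Finset.sum_comm]
          refine Finset.sum_congr rfl fun p _ => ?_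
          rw [Finset.sum_comm]
          refine Finset.sum_congr rfl fun a _ => ?_
          rw [Finset.sum_comm]
          refine Finset.sum_congr rfl fun q _ => ?_
          rw [Finset.sum_comm]
          refine Finset.sum_congr rfl fun b _ => Finset.sum_congr rfl fun i _ => by ring
      _ = 0 := by
          refine Finset.sum_eq_zero fun l _ => ?_
          have := congrArg (Int.cast : ℤ → ℂ) (hφ l)
          push_cast at this
          rw [this, zero_mul]
  have h0 := (Finset.sum_eq_zero_iff_of_nonneg
    (fun i _ => mul_star_self_nonneg (∑ p, ∑ a, (φ p a : ℂ) * (x i p * y i a)))).1 key i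
    (Finset.mem_univ i)
  rcases mul_eq_zero.1 h0 with h0 | h0
  · exact h0
  · exact star_eq_zero.1 h0

/-- The range criterion: no product vector is compatible with the ranges of the Horodecki state and
of its partial transpose. -/
theorem horodecki_not_separable {ι : Type*} [Fintype ι] (x : ι → Fin 2 → ℂ) (y : ι → Fin 4 → ℂ) :
    ¬ ∀ p q a b, ∑ i, x i p * star (x i q) * (y i a * star (y i b)) =
      ∑ l, (horodeckiVec l p a : ℂ) * horodeckiVec l q b := by
  intro h
  -- Conjugating the first factors of a product decomposition gives one of the partial transpose.
  have hT : ∀ p q a b, ∑ i, star (x i p) * star (star (x i q)) * (y i a * star (y i b)) =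
      ∑ l, (horodeckiVecT l p a : ℂ) * horodeckiVecT l q b := by
    intro p q a b
    have h1 := congrArg (Int.cast : ℤ → ℂ) (horodecki_partialTranspose p q a b)
    push_cast at h1
    rw [← h1, ← h]
    exact Finset.sum_congr rfl fun i _ => by rw [star_star]; ring
  have hz : ∀ i, x i 0 * y i 0 = 0 := by
    intro i
    have e1 := sum_mul_eq_zero_of_orthogonal x y _ h !![-1, 0, 0, 0; 0, 1, 0, 0] (by decide) i
    have e2 := sum_mul_eq_zero_of_orthogonal x y _ h !![0, -1, 0, 0; 0, 0, 1, 0] (by decide) i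
    have e3 := sum_mul_eq_zero_of_orthogonal x y _ h !![0, 0, 5, 0; 3, 0, 0, -5] (by decide) i
    have e4 := sum_mul_eq_zero_of_orthogonal (fun i p => star (x i p)) y _ hT
      !![0, 0, -1, 0; 0, 1, 0, 0] (by decide) i
    have e5 := sum_mul_eq_zero_of_orthogonal (fun i p => star (x i p)) y _ hT
      !![0, 0, 0, -1; 0, 0, 1, 0] (by decide) i
    simp only [Fin.sum_univ_two, Fin.sum_univ_four, Matrix.of_apply, Matrix.cons_val] at e1 e2 e3 e4 e5
    push_cast at e1 e2 e3 e4 e5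
    generalize x i 0 = x0 at *
    generalize x i 1 = x1 at *
    generalize y i 0 = y0 at *
    generalize y i 1 = y1 at *
    generalize y i 2 = y2 at *
    generalize y i 3 = y3 at *
    by_contra hne
    have hx1 : x1 ≠ 0 := by
      rintro rfl
      exact hne (by linear_combination -e1)
    -- With `t = x0 / x1` the range conditions force `|t| = 1`, hence `t y2 = y3`, and the third
    -- condition leaves `3 y0 = 0`.
    obtain ⟨t, rfl⟩ : ∃ t, x0 = t * x1 := ⟨x0 / x1, by field_simp⟩
    have hs1 : star x1 ≠ 0 := star_ne_zero.2 hx1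
    rw [star_mul'] at e4 e5
    have f1 : y1 = t * y0 := mul_left_cancel₀ hx1 (by linear_combination e1)
    have f2 : y2 = t * y1 := mul_left_cancel₀ hx1 (by linear_combination e2)
    have f3 : 5 * t * y2 + 3 * y0 - 5 * y3 = 0 := mul_left_cancel₀ hx1 (by linear_combination e3)
    have f4 : y1 = star t * y2 := mul_left_cancel₀ hs1 (by linear_combination e4)
    have f5 : y2 = star t * y3 := mul_left_cancel₀ hs1 (by linear_combination e5)
    have ht : t ≠ 0 := by
      rintro rfl
      exact hne (by ring)
    have hy0 : y0 ≠ 0 := by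
      rintro rfl
      exact hne (by ring)
    have hy1 : y1 ≠ 0 := f1 ▸ mul_ne_zero ht hy0
    have htt : t * star t = 1 := mul_right_cancel₀ hy1 (by linear_combination -f4 - star t * f2)
    exact hy0 (by linear_combination f3 / 3 - 5 / 3 * t * f5 - 5 / 3 * y3 * htt)
  -- All product terms vanish at this diagonal entry, whose value is `16`.
  have h0 := h 0 0 0 0
  have hl : ∑ i, x i 0 * star (x i 0) * (y i 0 * star (y i 0)) = 0 :=
    Finset.sum_eq_zero fun i _ => by linear_combination star (x i 0) * star (y i 0) * hz i
  rw [hl] at h0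
  simp [horodeckiVec, Fin.sum_univ_five] at h0

end Horodecki

/-! ### The map with the Horodecki Choi matrix. -/

section HorodeckiMap

variable {d : ℕ}

/-- The isometry that embeds the first coordinates. -/
def coordEmbed (n d : ℕ) (h : n ≤ d) : Matrix (Fin d) (Fin n) ℂ :=
  (1 : Mat d).submatrix id (Fin.castLE h)

theorem coordEmbed_conj {n : ℕ} (h : n ≤ d) (X : Mat d) :
    (coordEmbed n d h)ᴴ * X * coordEmbed n d h = X.submatrix (Fin.castLE h) (Fin.castLE h) := by
  ext p q
  simp [coordEmbed, Matrix.mul_apply, Matrix.one_apply]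

theorem coordEmbed_isometry {n : ℕ} (h : n ≤ d) :
    (coordEmbed n d h)ᴴ * coordEmbed n d h = 1 := by
  have := coordEmbed_conj h 1
  rw [Matrix.mul_one] at this
  rw [this, Matrix.submatrix_one _ (Fin.castLE_injective h)]

/-- The completely positive map on the `d × d` matrices with the Kraus operators `V l`, which act
from the first four to the first two coordinates. -/
noncomputable def krausMap (hd : 4 ≤ d) (V : Fin 5 → Matrix (Fin 2) (Fin 4) ℤ) : MatMap d d :=
  ∑ l, conjMap (coordEmbed 2 d (by omega) * (V l).map (Int.cast : ℤ → ℂ) * (coordEmbed 4 d hd)ᴴ)ᴴ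

/-- The map depends on `V` only through its Choi matrix, so an identity of Choi matrices yields one
of maps. -/
theorem krausMap_apply (hd : 4 ≤ d) (V : Fin 5 → Matrix (Fin 2) (Fin 4) ℤ) (X : Mat d) :
    krausMap hd V X = coordEmbed 4 d hd * (Matrix.of fun a b => ∑ p, ∑ q,
      X (Fin.castLE (by omega) p) (Fin.castLE (by omega) q) * ∑ l, (V l p a : ℂ) * V l q b) *
        (coordEmbed 4 d hd)ᴴ := by
  have h : (Matrix.of fun a b => ∑ p, ∑ q,
      X (Fin.castLE (by omega) p) (Fin.castLE (by omega) q) * ∑ l, (V l p a : ℂ) * V l q b) =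
      ∑ l, ((V l).map (Int.cast : ℤ → ℂ))ᴴ *
        ((coordEmbed 2 d (by omega))ᴴ * X * coordEmbed 2 d (by omega)) *
          (V l).map (Int.cast : ℤ → ℂ) := by
    ext a b
    simp only [coordEmbed_conj, Matrix.sum_apply, Matrix.mul_apply, Matrix.of_apply,
      Matrix.conjTranspose_apply, Matrix.map_apply, Matrix.submatrix_apply, star_intCast,
      Finset.sum_mul, Finset.mul_sum]
    rw [Finset.sum_comm' (t' := Finset.univ) (s' := fun _ => Finset.univ) (by simp)]
    symm
    rw [Finset.sum_comm]
    refine Finset.sum_congr rfl fun p _ => ?_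
    rw [Finset.sum_comm]
    refine Finset.sum_congr rfl fun q _ => Finset.sum_congr rfl fun l _ => by ring
  rw [h, krausMap, LinearMap.sum_apply, Matrix.mul_sum, Matrix.sum_mul]
  refine Finset.sum_congr rfl fun l _ => ?_
  simp only [conjMap_apply, Matrix.conjTranspose_mul, Matrix.conjTranspose_conjTranspose,
    Matrix.mul_assoc]

theorem isKPEB_krausMap (hd : 4 ≤ d) (V : Fin 5 → Matrix (Fin 2) (Fin 4) ℤ) :
    IsKPEB 2 (krausMap hd V) := by
  refine ⟨5, fun l => coordEmbed 2 d (by omega) * (V l).map (Int.cast : ℤ → ℂ) *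
    (coordEmbed 4 d hd)ᴴ, fun l => ?_, fun X => ?_⟩
  · exact ((Matrix.rank_mul_le_left _ _).trans (Matrix.rank_mul_le_left _ _)).trans
      (Matrix.rank_le_width _)
  · simp [krausMap, conjMap_apply, Matrix.mul_assoc]

/-- Composition with `T` exchanges `p` and `q`, the partial transposition of the Choi matrix. -/
theorem krausMap_comp_T (hd : 4 ≤ d) :
    krausMap hd horodeckiVec ∘ₗ T d = krausMap hd horodeckiVecT := by
  refine LinearMap.ext fun X => ?_
  change krausMap hd horodeckiVec Xᵀ = _
  rw [krausMap_apply, krausMap_apply]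
  congr 3
  ext a b
  rw [Finset.sum_comm]
  refine Finset.sum_congr rfl fun p _ => Finset.sum_congr rfl fun q _ => ?_
  have h := congrArg (Int.cast : ℤ → ℂ) (horodecki_partialTranspose p q a b)
  push_cast at h
  rw [← h, Matrix.transpose_apply]

theorem krausMap_single (hd : 4 ≤ d) (V : Fin 5 → Matrix (Fin 2) (Fin 4) ℤ) (p q : Fin 2)
    (a b : Fin 4) :
    krausMap hd V (Matrix.single (Fin.castLE (by omega) p) (Fin.castLE (by omega) q) 1)
      (Fin.castLE hd a) (Fin.castLE hd b) = ∑ l, (V l p a : ℂ) * V l q b := by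
  have h := coordEmbed_conj hd
    (krausMap hd V (Matrix.single (Fin.castLE (by omega) p) (Fin.castLE (by omega) q) 1))
  have h' := congrFun (congrFun h a) b
  rw [Matrix.submatrix_apply] at h'
  rw [← h', krausMap_apply]
  have hassoc : ∀ (J : Matrix (Fin d) (Fin 4) ℂ) (M : Mat 4), Jᴴ * J = 1 →
      Jᴴ * (J * M * Jᴴ) * J = M := by
    intro J M hJ
    calc Jᴴ * (J * M * Jᴴ) * J = (Jᴴ * J) * M * (Jᴴ * J) := by simp only [Matrix.mul_assoc]
      _ = M := by rw [hJ, Matrix.one_mul, Matrix.mul_one]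
  rw [hassoc _ _ (coordEmbed_isometry hd)]
  have hs : ∀ p' q' : Fin 2, (Matrix.single (Fin.castLE (by omega) p) (Fin.castLE (by omega) q) 1 :
      Mat d) (Fin.castLE (by omega) p') (Fin.castLE (by omega) q') =
        if p = p' then if q = q' then 1 else 0 else 0 := by
    intro p' q'
    simp only [Matrix.single_apply, Fin.castLE_inj, ite_and]
  simp only [Matrix.of_apply, hs, ite_mul, zero_mul, one_mul, Finset.sum_ite_irrel,
    Finset.sum_const_zero, Finset.sum_ite_eq, Finset.mem_univ, if_true]

theorem krausMap_not_isKEB {k : ℕ} (hd : 4 ≤ d) (hk : 2 ≤ k) :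
    ¬ IsKEB k (krausMap hd horodeckiVec) := by
  intro h
  -- A maximally entangled vector truncated to `k` levels; as `k ≥ 2`, a corner of the output is the
  -- full Horodecki matrix.
  let ω : Fin k × Fin d → ℂ := fun p => if (p.1 : ℕ) = p.2 then 1 else 0
  obtain ⟨ι, _, x, y, hxy⟩ := isSeparable_iff_exists_vec.1
    (h.2 _ (Matrix.posSemidef_vecMulVec_self_star ω))
  refine horodecki_not_separable (fun i p => x i (Fin.castLE hk p))
    (fun i a => y i (Fin.castLE hd a)) fun p q a b => ?_
  have hb : block (Matrix.vecMulVec ω (star ω)) (Fin.castLE hk p) (Fin.castLE hk q) =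
      Matrix.single (Fin.castLE (by omega) p) (Fin.castLE (by omega) q) 1 := by
    ext a b
    simp only [block_apply, Matrix.vecMulVec_apply, ω, Pi.star_apply, Matrix.single_apply,
      Fin.ext_iff, Fin.val_castLE]
    split_ifs <;> simp_all
  rw [← krausMap_single hd, ← hb]
  have := congrFun (congrFun hxy (Fin.castLE hk p, Fin.castLE hd a))
    (Fin.castLE hk q, Fin.castLE hd b)
  rw [idTensor_apply] at this
  rw [this]
  simp [Matrix.sum_apply, Matrix.kroneckerMap_apply, Matrix.vecMulVec_apply]

end HorodeckiMap

/-- A cone of `k`-entanglement breaking maps that contains `X ↦ k tr(X) 1 - Xᵀ` is not typical. -/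
theorem not_isTypical_of_subset_EBk {d k : ℕ} (hd : 4 ≤ d) (hk : 1 < k) (hkd : k < d)
    {C : Set (MatMap d d)} (hC : C ⊆ EBk k d d) (h : transposedReduction k d ∈ C) :
    ¬ IsTypical C := by
  intro hT
  rcases (hT.eq_EB_or_subset (by omega)).2 with rfl | hsub
  · exact not_isEB_transposedReduction hkd h
  · refine krausMap_not_isKEB hd hk (hC (hsub ⟨isKPEB_krausMap hd _, mem_compT_iff.2 ?_⟩))
    rw [krausMap_comp_T]
    exact isKPEB_krausMap hd _

end MappingCones

theorem mainTheorem4 (d k : ℕ) (hd : 4 ≤ d) (hk : 1 < k) (hkd : k < d) :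
    (MappingCones.IsMappingCone (MappingCones.EBk k d d) ∧
      ¬ MappingCones.IsTypical (MappingCones.EBk k d d)) ∧
    (MappingCones.IsMappingCone (MappingCones.EBCPk k d d) ∧
      ¬ MappingCones.IsTypical (MappingCones.EBCPk k d d)) := by
  refine ⟨⟨MappingCones.isMappingCone_EBk hk.le, ?_⟩, MappingCones.isMappingCone_EBCPk hk.le, ?_⟩
  · exact MappingCones.not_isTypical_of_subset_EBk hd hk hkd subset_rfl
      (MappingCones.isKEB_transposedReduction k d)
  · exact MappingCones.not_isTypical_of_subset_EBk hd hk hkd (fun _ h => h.1)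
      ⟨MappingCones.isKEB_transposedReduction k d,
        MappingCones.isCP_transposedReduction hk.le⟩
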